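/- Let $\mathbb K$ be an algebraically closed field, let $n_1,\dots,n_s$ and $d_1,\dots,d_s$ be non-negative integers, put $n=\sum_j n_j$ and $d=\sum_j d_j$, and assume that $\mathrm{char}\,\mathbb K=0$ or $\mathrm{char}\,\mathbb K>d$. Let $R_{\mathbf d}$ be the space of polynomials over $\mathbb K$ in the variables $x_{i,j}$ ($1\le j\le s$, $0\le i\le n_j$) that are homogeneous of degree $d_j$ in $x_{0,j},\dots,x_{n_j,j}$ for every $j$. Let $X\subset\mathbb P(R_{\mathbf d})$ be the Segre–Veronese variety, the image of $\mathbb P^{n_1}\times\cdots\times\mathbb P^{n_s}$ under $([L_1],\dots,[L_s])\mapsto[L_1^{d_1}\cdots L_s^{d_s}]$, where $L_j$ is a nonzero linear form in $x_{0,j},\dots,x_{n_j,j}$, with its reduced scheme structure. For a nonzero $f\in R_{\mathbf d}$, the cactus rank $cr_{\mathbf d}(f)$ is the minimal length $\dim_{\mathbb K}H^0(Z,\mathcal O_Z)$ of a zero-dimensional closed subscheme $Z\subset X$ such that $[f]\in\langle Z\rangle$, where $\langle Z\rangle$ is the smallest linear subspace of $\mathbb P(R_{\mathbf d})$ containing $Z$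 as a subscheme. **Theorem.** For every nonzero $f\in R_{\mathbf d}$ and every integer $k\ge 0$: - if $d=2k+2$, then $cr_{\mathbf d}(f)\le\binom{n+k}{k}+\binom{n+k+1}{k+1}$; - if $d=2k+1$, then $cr_{\mathbf d}(f)\le 2\binom{n+k}{k}$. In particular such a $Z$ exists in both cases. -/

import Mathlib

open AlgebraicGeometry CategoryTheory

universe u

namespace CactusRank

noncomputable section

section ProjectiveSchemes

attribute [local instance] MvPolynomial.gradedAlgebra

/-- The projective space over `K` with homogeneous coordinates indexed by `ι`, that is
`Proj K[y_v : v ∈ ι]` for the standard grading. -/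
abbrev ProjSpace (K : Type u) [Field K] (ι : Type) : Scheme.{u} :=
  Proj (MvPolynomial.homogeneousSubmodule ι K)

/-- The structure morphism `ProjSpace K ι ⟶ Spec K`. -/
def structureMorphism (K : Type u) [Field K] (ι : Type) :
    ProjSpace K ι ⟶ Spec (CommRingCat.of K) :=
  Proj.toSpecZero (MvPolynomial.homogeneousSubmodule ι K) ≫
    Spec.map (CommRingCat.ofHom
      (algebraMap K (MvPolynomial.homogeneousSubmodule ι K 0)))

/-- For `g` homogeneous of degree `t` and a coordinate `y_v`, the regular function `g / y_v ^ t`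
on the standard affine chart `{y_v ≠ 0}` of projective space. -/
def chartFunction {K : Type u} [Field K] {ι : Type} (v : ι) {t : ℕ} (g : MvPolynomial ι K)
    (hg : g.IsHomogeneous t) :
    Γ(ProjSpace K ι,
      Proj.basicOpen (MvPolynomial.homogeneousSubmodule ι K) (MvPolynomial.X v)) :=
  (Proj.awayToSection (MvPolynomial.homogeneousSubmodule ι K) (MvPolynomial.X v)).hom
    (HomogeneousLocalization.Away.mk (MvPolynomial.homogeneousSubmodule ι K) (d := 1)
      (MvPolynomial.isHomogeneous_X K v) t g (by simpa using hg))

/-- A zero-dimensional closed subscheme of projective space: a closed subscheme that is finite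
over `K`. -/
structure ZeroDimSubscheme (K : Type u) [Field K] (ι : Type) where
  /-- the underlying scheme -/
  carrier : Scheme.{u}
  /-- the inclusion -/
  incl : carrier ⟶ ProjSpace K ι
  isClosedImmersion : IsClosedImmersion incl
  isFinite : IsFinite (incl ≫ structureMorphism K ι)

namespace ZeroDimSubscheme

variable {K : Type u} [Field K] {ι : Type}

/-- The ring homomorphism `K → Γ(Z, O_Z)` given by the structure morphism `Z ⟶ Spec K`. -/
def scalars (Z : ZeroDimSubscheme K ι) : K →+* Γ(Z.carrier, ⊤) :=
  (Z.incl ≫ structureMorphism K ι).appTop.hom.comp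
    (Scheme.ΓSpecIso (CommRingCat.of K)).inv.hom

/-- The length of `Z`, the dimension over `K` of the ring `Γ(Z, O_Z)`. It is finite because `Z` is
finite over `K`. -/
def length (Z : ZeroDimSubscheme K ι) : ℕ :=
  @Module.finrank K Γ(Z.carrier, ⊤) _ _ Z.scalars.toAlgebra.toModule

/-- The homogeneous polynomial `g` vanishes on `Z` scheme-theoretically: on every standard chart
the restriction to `Z` of the regular function `g / y_v ^ t` is zero. -/
def Vanishes (Z : ZeroDimSubscheme K ι) {t : ℕ} (g : MvPolynomial ι K)
    (hg : g.IsHomogeneous t) : Prop :=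
  ∀ v : ι, (Z.incl.app _).hom (chartFunction v g hg) = 0

/-- `Z` is a closed subscheme of the projective variety `{[a] : a ∈ S}` (with its reduced
structure): every homogeneous polynomial that is zero at all points of `S` vanishes
scheme-theoretically on `Z`. -/
def ContainedIn (Z : ZeroDimSubscheme K ι) (S : Set (ι → K)) : Prop :=
  ∀ (t : ℕ) (g : MvPolynomial ι K) (hg : g.IsHomogeneous t),
    (∀ a ∈ S, MvPolynomial.eval a g = 0) → Z.Vanishes g hg

/-- The point with homogeneous coordinates `p` lies in the linear span of `Z`, the smallest
linear subspace of projective space that contains `Z` as a subscheme: every linear form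
vanishing on `Z` is zero at `p`. -/
def SpanContains (Z : ZeroDimSubscheme K ι) (p : ι → K) : Prop :=
  ∀ (l : MvPolynomial ι K) (hl : l.IsHomogeneous 1),
    Z.Vanishes l hl → MvPolynomial.eval p l = 0

end ZeroDimSubscheme

end ProjectiveSchemes

section SegreVeronese

variable {s : ℕ}

/-- The variables `x_{i,j}`, `0 ≤ i ≤ n_j`, in `s` groups; `⟨j, i⟩` stands for `x_{i,j}`. -/
abbrev Var (n : Fin s → ℕ) : Type := Σ j : Fin s, Fin (n j + 1)

/-- The multidegree of a variable: the variables of the `j`-th group have multidegree `e_j`. -/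
def varDegree (n : Fin s → ℕ) (v : Var n) : Fin s → ℕ := Pi.single v.1 1

/-- `f` is multihomogeneous of multidegree `d = (d_1, …, d_s)`, that is `f ∈ R_d`. -/
def IsMultihomogeneous {K : Type u} [Field K] (n d : Fin s → ℕ)
    (f : MvPolynomial (Var n) K) : Prop :=
  f.IsWeightedHomogeneous (varDegree n) d

/-- The exponents of the monomials of multidegree `d`. These monomials form a basis of `R_d`, so
they index the homogeneous coordinates on `ℙ(R_d)`. -/
abbrev Exponent (n d : Fin s → ℕ) : Type :=
  {m : Var n →₀ ℕ // Finsupp.weight (varDegree n) m = d}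

/-- The homogeneous coordinates of the point `[f]` of `ℙ(R_d)`: the coefficients of `f`. -/
def coords {K : Type u} [Field K] (n d : Fin s → ℕ) (f : MvPolynomial (Var n) K) :
    Exponent n d → K :=
  fun m => f.coeff m.1

/-- The linear form `∑ i, a_i x_{i,j}` in the `j`-th group of variables. -/
def linearForm {K : Type u} [Field K] (n : Fin s → ℕ) (j : Fin s) (a : Fin (n j + 1) → K) :
    MvPolynomial (Var n) K :=
  ∑ i, MvPolynomial.C (a i) * MvPolynomial.X ⟨j, i⟩

/-- The Segre–Veronese map `([L_1], …, [L_s]) ↦ [L_1 ^ d_1 ⋯ L_s ^ d_s]`, in coordinates. -/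
def segreVeronese {K : Type u} [Field K] (n d : Fin s → ℕ)
    (a : (j : Fin s) → Fin (n j + 1) → K) : Exponent n d → K :=
  coords n d (∏ j, linearForm n j (a j) ^ d j)

/-- The (coordinate vectors of) points of the Segre–Veronese variety in `ℙ(R_d)`. -/
def segreVeroneseVariety (K : Type u) [Field K] (n d : Fin s → ℕ) : Set (Exponent n d → K) :=
  {p | ∃ a : (j : Fin s) → Fin (n j + 1) → K, (∀ j, a j ≠ 0) ∧ p = segreVeronese n d a}

/-- The cactus rank of `[f] ∈ ℙ(R_d)`: the minimal length of a zero-dimensional subscheme `Z` of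
the Segre–Veronese variety whose linear span contains `[f]` (`⊤` if there is no such `Z`). -/
def cactusRank {K : Type u} [Field K] (n d : Fin s → ℕ) (f : MvPolynomial (Var n) K) : ℕ∞ :=
  sInf {l : ℕ∞ | ∃ Z : ZeroDimSubscheme K (Exponent n d),
    Z.ContainedIn (segreVeroneseVariety K n d) ∧ Z.SpanContains (coords n d f) ∧
      l = (Z.length : ℕ∞)}

end SegreVeronese

end

end CactusRank

namespace CactusRank

section Proj

variable {A : Type u} {S : Type*} [CommRing A] [SetLike S A] [AddSubgroupClass S A]
  (𝒜 : ℕ → S) [GradedRing 𝒜]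

theorem awayι_preimage_basicOpen_self {f : A} {m : ℕ} (hf : f ∈ 𝒜 m) (hm : 0 < m) :
    Proj.awayι 𝒜 f hf hm ⁻¹ᵁ Proj.basicOpen 𝒜 f = ⊤ := by
  rw [← Proj.opensRange_awayι 𝒜 f hf hm, Scheme.Hom.preimage_opensRange]

theorem awayToSection_appLE_awayι {f : A} {m : ℕ} (hf : f ∈ 𝒜 m) (hm : 0 < m) :
    Proj.awayToSection 𝒜 f ≫ (Proj.awayι 𝒜 f hf hm).appLE (Proj.basicOpen 𝒜 f) ⊤
      (awayι_preimage_basicOpen_self 𝒜 hf hm).ge = (Scheme.ΓSpecIso _).inv := by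
  have h1 : Proj.basicOpenToSpec 𝒜 f ≫ Proj.awayι 𝒜 f hf hm = (Proj.basicOpen 𝒜 f).ι := by
    rw [← Proj.basicOpenIsoSpec_hom 𝒜 f hf hm, Proj.awayι, Iso.hom_inv_id_assoc]
  have h2 : (Proj.awayι 𝒜 f hf hm).appLE (Proj.basicOpen 𝒜 f) ⊤
      (awayι_preimage_basicOpen_self 𝒜 hf hm).ge ≫ (Proj.basicOpenToSpec 𝒜 f).appTop =
      (Proj.basicOpen 𝒜 f).topIso.inv := by
    rw [Scheme.Hom.appTop, Scheme.Hom.app_eq_appLE (Proj.basicOpenToSpec 𝒜 f)]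
    erw [Scheme.Hom.appLE_comp_appLE]
    simp only [h1, Scheme.Opens.ι_appLE, Scheme.Opens.topIso_inv]
    rfl
  have h3 := Proj.basicOpenToSpec_app_top 𝒜 f
  have : IsIso (Proj.awayToSection 𝒜 f) := by
    rw [← Proj.basicOpenIsoAway_hom 𝒜 f hf hm]; infer_instance
  rw [Scheme.Hom.appTop, h3] at h2
  rw [← cancel_mono (Scheme.ΓSpecIso _).hom, Iso.inv_hom_id, ← cancel_mono (Proj.awayToSection 𝒜 f),
    ← cancel_mono (Proj.basicOpen 𝒜 f).topIso.inv]
  simp only [Category.assoc, Category.id_comp]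
  rw [h2]

end Proj

section Geometry

attribute [local instance] MvPolynomial.gradedAlgebra

variable {K : Type u} [Field K] {ι : Type} {A : Type u} [CommRing A] [Algebra K A]

theorem X_mem_homogeneousSubmodule (v : ι) :
    (MvPolynomial.X v : MvPolynomial ι K) ∈ MvPolynomial.homogeneousSubmodule ι K 1 :=
  MvPolynomial.isHomogeneous_X K v

/-- The degree zero fraction `g / y_v ^ t`. -/
noncomputable def awayFraction (v : ι) {t : ℕ} (g : MvPolynomial ι K) (hg : g.IsHomogeneous t) :
    HomogeneousLocalization.Away (MvPolynomial.homogeneousSubmodule ι K) (MvPolynomial.X v) :=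
  HomogeneousLocalization.Away.mk _ (X_mem_homogeneousSubmodule v) t g (by simpa using hg)

theorem exists_awayMap_awayFraction_eq_mul (v w : ι) {t : ℕ} (g : MvPolynomial ι K)
    (hg : g.IsHomogeneous t) {x : MvPolynomial ι K} (hx : x = MvPolynomial.X v * MvPolynomial.X w)
    (hx' : x = MvPolynomial.X w * MvPolynomial.X v) :
    ∃ u, HomogeneousLocalization.awayMap (MvPolynomial.homogeneousSubmodule ι K)
        (X_mem_homogeneousSubmodule v) hx' (awayFraction w g hg) =
      HomogeneousLocalization.awayMap (MvPolynomial.homogeneousSubmodule ι K)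
        (X_mem_homogeneousSubmodule w) hx (awayFraction v g hg) * u := by
  have hx2 : x ∈ MvPolynomial.homogeneousSubmodule ι K 2 :=
    hx ▸ SetLike.mul_mem_graded (X_mem_homogeneousSubmodule v) (X_mem_homogeneousSubmodule w)
  have hu : (MvPolynomial.X v ^ t * MvPolynomial.X v ^ t : MvPolynomial ι K) ∈
      MvPolynomial.homogeneousSubmodule ι K (t • 2) := by
    rw [← pow_add, ← mul_two]
    simpa using SetLike.pow_mem_graded (t * 2) (X_mem_homogeneousSubmodule (K := K) v)
  refine ⟨HomogeneousLocalization.Away.mk _ hx2 t _ hu, ?_⟩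
  apply HomogeneousLocalization.val_injective
  rw [HomogeneousLocalization.val_mul, awayFraction, awayFraction,
    HomogeneousLocalization.awayMap_mk, HomogeneousLocalization.awayMap_mk,
    HomogeneousLocalization.Away.val_mk, HomogeneousLocalization.Away.val_mk,
    HomogeneousLocalization.Away.val_mk, Localization.mk_mul, Localization.mk_eq_mk_iff,
    Localization.r_iff_exists]
  refine ⟨1, ?_⟩
  simp only [Submonoid.coe_mul, hx]
  ring

/-- The evaluation of degree zero fractions `g / y_v ^ t` at a point with coordinates in `A` whose
`v`-th coordinate is `1`. -/
noncomputable def evalAway (a : ι → A) (v : ι) (hv : a v = 1) :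
    HomogeneousLocalization.Away (MvPolynomial.homogeneousSubmodule ι K) (MvPolynomial.X v) →+* A :=
  (IsLocalization.Away.lift (S := Localization.Away (MvPolynomial.X v : MvPolynomial ι K))
    (MvPolynomial.X v) (g := (MvPolynomial.aeval a : MvPolynomial ι K →ₐ[K] A).toRingHom)
    (by simp [hv])).comp (algebraMap _ _)

theorem evalAway_mk (a : ι → A) (v : ι) (hv : a v = 1) {t : ℕ} (g : MvPolynomial ι K)
    (hg : g ∈ MvPolynomial.homogeneousSubmodule ι K (t • 1)) :
    evalAway a v hv (HomogeneousLocalization.Away.mk (MvPolynomial.homogeneousSubmodule ι K)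
      (d := 1) (X_mem_homogeneousSubmodule v) t g hg) = MvPolynomial.aeval a g := by
  rw [evalAway, RingHom.comp_apply, HomogeneousLocalization.algebraMap_apply,
    HomogeneousLocalization.Away.val_mk, Localization.mk_eq_mk', IsLocalization.Away.lift,
    IsLocalization.lift_mk'_spec]
  simp [hv]

theorem evalAway_surjective (a : ι → A) (v : ι) (hv : a v = 1)
    (ha : Algebra.adjoin K (Set.range a) = ⊤) : Function.Surjective (evalAway (K := K) a v hv) := by
  intro x
  have hx : x ∈ Algebra.adjoin K (Set.range a) := ha ▸ Algebra.mem_top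
  change x ∈ (evalAway (K := K) a v hv).range
  induction hx using Algebra.adjoin_induction with
  | mem x hx =>
    obtain ⟨i, rfl⟩ := hx
    exact ⟨_, (evalAway_mk a v hv (t := 1) (MvPolynomial.X i)
      (MvPolynomial.isHomogeneous_X K i)).trans (by simp)⟩
  | algebraMap r =>
    exact ⟨_, (evalAway_mk a v hv (t := 0) (MvPolynomial.C r)
      (MvPolynomial.isHomogeneous_C _ _)).trans (by simp)⟩
  | add x y _ _ hx hy => exact add_mem hx hy
  | mul x y _ _ hx hy => exact mul_mem hx hy

variable (K) in
/-- The morphism `Spec A ⟶ ProjSpace K ι` with homogeneous coordinates `a`, one of which is `1`. -/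
noncomputable def specToProjSpace (a : ι → A) (v : ι) (hv : a v = 1) :
    Spec (CommRingCat.of A) ⟶ ProjSpace K ι :=
  Spec.map (CommRingCat.ofHom (evalAway (K := K) a v hv)) ≫
    Proj.awayι _ _ (X_mem_homogeneousSubmodule v) one_pos

theorem specToProjSpace_structureMorphism (a : ι → A) (v : ι) (hv : a v = 1) :
    specToProjSpace K a v hv ≫ structureMorphism K ι =
      Spec.map (CommRingCat.ofHom (algebraMap K A)) := by
  rw [specToProjSpace, structureMorphism, Category.assoc, Proj.awayι_toSpecZero_assoc,
    ← Spec.map_comp, ← Spec.map_comp, ← CommRingCat.ofHom_comp, ← CommRingCat.ofHom_comp]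
  congr 2
  ext r
  have := evalAway_mk a v hv (t := 0) (MvPolynomial.C r)
    (MvPolynomial.isHomogeneous_C _ _)
  rw [MvPolynomial.aeval_C] at this
  rw [← this]
  simp only [RingHom.comp_apply]
  congr 1

instance : IsSeparated (structureMorphism K ι) := by
  unfold structureMorphism; infer_instance

theorem isFinite_specToProjSpace_structureMorphism [Module.Finite K A] (a : ι → A) (v : ι)
    (hv : a v = 1) : IsFinite (specToProjSpace K a v hv ≫ structureMorphism K ι) := by
  rw [specToProjSpace_structureMorphism, IsFinite.SpecMap_iff]
  exact RingHom.finite_algebraMap.mpr inferInstance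

theorem isClosedImmersion_specToProjSpace [Module.Finite K A] (a : ι → A) (v : ι) (hv : a v = 1)
    (ha : Algebra.adjoin K (Set.range a) = ⊤) : IsClosedImmersion (specToProjSpace K a v hv) := by
  have := isFinite_specToProjSpace_structureMorphism (K := K) a v hv
  have : IsClosedImmersion (Spec.map (CommRingCat.ofHom (evalAway (K := K) a v hv))) :=
    IsClosedImmersion.spec_of_surjective _ (evalAway_surjective a v hv ha)
  rw [IsClosedImmersion.iff_isProper_and_mono]
  exact ⟨IsProper.of_comp _ (structureMorphism K ι), by unfold specToProjSpace; infer_instance⟩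

theorem specToProjSpace_preimage (a : ι → A) (v : ι) (hv : a v = 1) :
    specToProjSpace K a v hv ⁻¹ᵁ Proj.basicOpen _ (MvPolynomial.X v) = ⊤ := by
  rw [specToProjSpace, Scheme.Hom.comp_preimage, awayι_preimage_basicOpen_self]
  rfl

theorem appLE_chartFunction (a : ι → A) (v : ι) (hv : a v = 1) {t : ℕ} (g : MvPolynomial ι K)
    (hg : g.IsHomogeneous t) :
    ((specToProjSpace K a v hv).appLE _ ⊤ (specToProjSpace_preimage a v hv).ge).hom
      (chartFunction v g hg) = (Scheme.ΓSpecIso (CommRingCat.of A)).inv (MvPolynomial.aeval a g) := by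
  have h := awayToSection_appLE_awayι (MvPolynomial.homogeneousSubmodule ι K)
    (X_mem_homogeneousSubmodule v) one_pos
  have h' : Proj.awayToSection _ _ ≫
      (specToProjSpace K a v hv).appLE _ ⊤ (specToProjSpace_preimage a v hv).ge =
      CommRingCat.ofHom (evalAway (K := K) a v hv) ≫ (Scheme.ΓSpecIso (CommRingCat.of A)).inv := by
    have h₂ : (Spec.map (CommRingCat.ofHom (evalAway (K := K) a v hv))).appTop =
        (Spec.map (CommRingCat.ofHom (evalAway (K := K) a v hv))).appLE ⊤ ⊤
          (Scheme.Hom.preimage_top _).ge :=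
      Scheme.Hom.app_eq_appLE _
    rw [Scheme.ΓSpecIso_inv_naturality, ← h, h₂, Category.assoc, Scheme.Hom.appLE_comp_appLE]
    rfl
  rw [← evalAway_mk a v hv g (by simpa using hg)]
  exact congr($h' _)

theorem app_chartFunction_eq_zero (a : ι → A) (v : ι) (hv : a v = 1) {t : ℕ} (g : MvPolynomial ι K)
    (hg : g.IsHomogeneous t) (h : MvPolynomial.aeval a g = 0) (w : ι) :
    ((specToProjSpace K a v hv).app _).hom (chartFunction w g hg) = 0 := by
  let f := specToProjSpace K a v hv
  let x : MvPolynomial ι K := MvPolynomial.X v * MvPolynomial.X w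
  have hx : x = MvPolynomial.X v * MvPolynomial.X w := rfl
  have hx' : x = MvPolynomial.X w * MvPolynomial.X v := mul_comm _ _
  let 𝒜 := MvPolynomial.homogeneousSubmodule ι K
  have hle : f ⁻¹ᵁ Proj.basicOpen 𝒜 (MvPolynomial.X w) ≤ f ⁻¹ᵁ Proj.basicOpen 𝒜 x := by
    intro z hz
    have hz' : z ∈ f ⁻¹ᵁ Proj.basicOpen 𝒜 (MvPolynomial.X v) :=
      (specToProjSpace_preimage a v hv).ge trivial
    change f z ∈ Proj.basicOpen 𝒜 (MvPolynomial.X v * MvPolynomial.X w)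
    rw [Proj.basicOpen_mul]
    exact ⟨hz', hz⟩
  have hv' := congr($(Proj.awayMap_awayToSection 𝒜 (X_mem_homogeneousSubmodule w) hx)
    (awayFraction v g hg))
  have hw' := congr($(Proj.awayMap_awayToSection 𝒜 (X_mem_homogeneousSubmodule v) hx')
    (awayFraction w g hg))
  obtain ⟨u, hu⟩ := exists_awayMap_awayFraction_eq_mul v w g hg hx hx'
  rw [CommRingCat.comp_apply, CommRingCat.comp_apply] at hv' hw'
  have hzero : f.appLE (Proj.basicOpen 𝒜 x) _ hle (Proj.awayToSection 𝒜 x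
      (HomogeneousLocalization.awayMap 𝒜 (X_mem_homogeneousSubmodule w) hx
        (awayFraction v g hg))) = 0 := by
    erw [hv']
    rw [← CommRingCat.comp_apply, Scheme.Hom.map_appLE]
    have := appLE_chartFunction a v hv g hg
    rw [h, map_zero] at this
    rw [← Scheme.Hom.appLE_map f (specToProjSpace_preimage a v hv).ge (homOfLE le_top).op,
      CommRingCat.comp_apply]
    erw [this]
    rw [map_zero]
  rw [Scheme.Hom.app_eq_appLE,
    ← Scheme.Hom.map_appLE f hle (homOfLE (Proj.basicOpen_mono 𝒜 _ _ ⟨_, hx'⟩)).op]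
  rw [CommRingCat.hom_comp, RingHom.comp_apply]
  erw [← hw', hu]
  rw [map_mul, map_mul]
  erw [hzero]
  rw [zero_mul]

theorem exists_zeroDimSubscheme [Module.Finite K A] (a : ι → A) (v : ι) (hv : a v = 1)
    (ha : Algebra.adjoin K (Set.range a) = ⊤) :
    ∃ Z : ZeroDimSubscheme K ι, Z.length = Module.finrank K A ∧
      ∀ (t : ℕ) (g : MvPolynomial ι K) (hg : g.IsHomogeneous t),
        Z.Vanishes g hg ↔ MvPolynomial.aeval a g = 0 := by
  let Z : ZeroDimSubscheme K ι :=
    { carrier := Spec (CommRingCat.of A)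
      incl := specToProjSpace K a v hv
      isClosedImmersion := isClosedImmersion_specToProjSpace a v hv ha
      isFinite := isFinite_specToProjSpace_structureMorphism a v hv }
  refine ⟨Z, ?_, fun t g hg => ⟨fun h => ?_, app_chartFunction_eq_zero a v hv g hg⟩⟩
  · have hs : Z.scalars = (Scheme.ΓSpecIso (CommRingCat.of A)).inv.hom.comp (algebraMap K A) := by
      have := Scheme.ΓSpecIso_inv_naturality (CommRingCat.ofHom (algebraMap K A))
      rw [← specToProjSpace_structureMorphism a v hv] at this
      exact congr(($this).hom).symm
    let e : A ≃+* Γ(Z.carrier, ⊤) :=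
      (Scheme.ΓSpecIso (CommRingCat.of A)).symm.commRingCatIsoToRingEquiv
    let : Module K Γ(Z.carrier, ⊤) := Z.scalars.toAlgebra.toModule
    let e' : A ≃ₗ[K] Γ(Z.carrier, ⊤) :=
      { e.toAddEquiv with
        map_smul' := fun c x => by
          change e (c • x) = Z.scalars c * e x
          rw [Algebra.smul_def, map_mul, hs]
          rfl }
    exact e'.finrank_eq.symm
  · have h0 := appLE_chartFunction a v hv g hg
    rw [Scheme.Hom.appLE, CommRingCat.hom_comp, RingHom.comp_apply] at h0
    erw [h v] at h0
    rw [map_zero] at h0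
    exact (map_eq_zero_iff _
      (Scheme.ΓSpecIso (CommRingCat.of A)).symm.commRingCatIsoToRingEquiv.injective).mp h0.symm

end Geometry

section Apolarity

variable {K : Type u} [Field K] {σ : Type*}

/-- The apolar ideal of a linear functional on a polynomial ring: the largest ideal contained in
its kernel. -/
def apolarIdeal (φ : MvPolynomial σ K →ₗ[K] K) : Ideal (MvPolynomial σ K) where
  carrier := {g | ∀ h, φ (g * h) = 0}
  add_mem' ha hb h := by rw [add_mul, map_add, ha h, hb h, add_zero]
  zero_mem' h := by rw [zero_mul, map_zero]
  smul_mem' c g hg h := by rw [smul_eq_mul, mul_comm c g, mul_assoc]; exact hg _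

theorem mem_apolarIdeal {φ : MvPolynomial σ K →ₗ[K] K} {g : MvPolynomial σ K} :
    g ∈ apolarIdeal φ ↔ ∀ h, φ (g * h) = 0 := Iff.rfl

/-- The Hankel operator `g ↦ (h ↦ φ (g * h))`. -/
noncomputable def hankel (φ : MvPolynomial σ K →ₗ[K] K) :
    MvPolynomial σ K →ₗ[K] (MvPolynomial σ K →ₗ[K] K) :=
  (LinearMap.mul K (MvPolynomial σ K)).compr₂ φ

theorem hankel_apply (φ : MvPolynomial σ K →ₗ[K] K) (g h : MvPolynomial σ K) :
    hankel φ g h = φ (g * h) := rfl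

theorem ker_hankel (φ : MvPolynomial σ K →ₗ[K] K) :
    LinearMap.ker (hankel φ) = (apolarIdeal φ).restrictScalars K := by
  ext g
  simp [mem_apolarIdeal, LinearMap.ext_iff, hankel_apply]

theorem finite_setOf_degree_le [Finite σ] (k : ℕ) : {m : σ →₀ ℕ | m.degree ≤ k}.Finite := by
  have := Fintype.ofFinite σ
  exact Finsupp.finite_of_degree_le k

theorem ncard_setOf_degree_le [Fintype σ] (k : ℕ) :
    {m : σ →₀ ℕ | m.degree ≤ k}.ncard = (Fintype.card σ + k).choose k := by
  classical
  induction k with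
  | zero => simp [Finsupp.degree_eq_zero_iff]
  | succ k ih =>
    have h : {m : σ →₀ ℕ | m.degree ≤ k + 1} =
        {m | m.degree ≤ k} ∪ ↑(Finset.univ.finsuppAntidiag (k + 1) : Finset (σ →₀ ℕ)) := by
      ext m
      simp [Finset.mem_finsuppAntidiag, Finsupp.degree_eq_sum, Nat.le_succ_iff]
    rw [h, Set.ncard_union_eq _ (finite_setOf_degree_le k) (Finset.finite_toSet _), ih,
      Set.ncard_coe_finset, Finset.card_finsuppAntidiag_nat_eq_choose, Finset.card_univ,
      ← add_assoc, Nat.add_sub_cancel, Nat.choose_succ_succ']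
    rw [Set.disjoint_left]
    intro m hm hm'
    simp [Finset.mem_finsuppAntidiag, ← Finsupp.degree_eq_sum] at hm hm'
    omega

variable [Fintype σ] {φ : MvPolynomial σ K →ₗ[K] K} {k l : ℕ}

theorem range_hankel_le
    (hφ : ∀ (m : σ →₀ ℕ) (c : K), k + l + 1 < m.degree → φ (MvPolynomial.monomial m c) = 0) :
    ∃ V W : Submodule K (MvPolynomial σ K →ₗ[K] K), LinearMap.range (hankel φ) ≤ V ⊔ W ∧
      Module.Finite K V ∧ Module.Finite K W ∧
      Module.finrank K V ≤ (Fintype.card σ + k).choose k ∧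
      Module.finrank K W ≤ (Fintype.card σ + l).choose l := by
  classical
  have hfk := finite_setOf_degree_le (σ := σ) k
  have hfl := finite_setOf_degree_le (σ := σ) l
  have := hfk.to_subtype
  have := hfl.to_subtype
  have := Fintype.ofFinite {m : σ →₀ ℕ | m.degree ≤ k}
  have := Fintype.ofFinite {m : σ →₀ ℕ | m.degree ≤ l}
  let v : {m : σ →₀ ℕ | m.degree ≤ k} → (MvPolynomial σ K →ₗ[K] K) :=
    fun m => hankel φ (MvPolynomial.monomial m.1 1)
  let W : Submodule K (MvPolynomial σ K →ₗ[K] K) :=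
    { carrier := {ψ | ∀ m : σ →₀ ℕ, l < m.degree → ψ (MvPolynomial.monomial m 1) = 0}
      add_mem' := fun ha hb m hm => by rw [LinearMap.add_apply, ha m hm, hb m hm, add_zero]
      zero_mem' := fun m _ => rfl
      smul_mem' := fun c ψ hψ m hm => by rw [LinearMap.smul_apply, hψ m hm, smul_zero] }
  let e : W →ₗ[K] ({m : σ →₀ ℕ | m.degree ≤ l} → K) :=
    LinearMap.pi fun m => (LinearMap.applyₗ (MvPolynomial.monomial m.1 1)).comp W.subtype
  have he : Function.Injective e := by
    rw [injective_iff_map_eq_zero]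
    intro ψ hψ
    apply Subtype.ext
    refine MvPolynomial.linearMap_ext fun m => LinearMap.ext_ring ?_
    rcases le_or_gt m.degree l with h | h
    · exact congrFun hψ ⟨m, h⟩
    · exact ψ.2 m h
  refine ⟨Submodule.span K (Set.range v), W, ?_, .span_of_finite K (Set.finite_range v),
    Module.Finite.of_injective e he, ?_, ?_⟩
  · rintro _ ⟨g, rfl⟩
    induction g using MvPolynomial.induction_on' with
    | add p q hp hq => rw [map_add]; exact add_mem hp hq
    | monomial m c =>
      rcases le_or_gt m.degree k with h | h
      · refine Submodule.mem_sup_left ?_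
        rw [show MvPolynomial.monomial m c = c • MvPolynomial.monomial m 1 by
          simp [MvPolynomial.smul_monomial], map_smul]
        exact Submodule.smul_mem _ _ (Submodule.subset_span ⟨⟨m, h⟩, rfl⟩)
      · refine Submodule.mem_sup_right fun m' hm' => ?_
        rw [hankel_apply, MvPolynomial.monomial_mul]
        exact hφ _ _ (by rw [map_add]; omega)
  · refine (finrank_range_le_card v).trans_eq ?_
    rw [← ncard_setOf_degree_le, ← Nat.card_coe_set_eq, Nat.card_eq_fintype_card]
  · refine (LinearMap.finrank_le_finrank_of_injective he).trans_eq ?_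
    rw [Module.finrank_fintype_fun_eq_card, ← ncard_setOf_degree_le, ← Nat.card_coe_set_eq,
      Nat.card_eq_fintype_card]

theorem finite_and_finrank_quotient_apolarIdeal_le
    (hφ : ∀ (m : σ →₀ ℕ) (c : K), k + l + 1 < m.degree → φ (MvPolynomial.monomial m c) = 0) :
    Module.Finite K (MvPolynomial σ K ⧸ apolarIdeal φ) ∧
      Module.finrank K (MvPolynomial σ K ⧸ apolarIdeal φ) ≤
        (Fintype.card σ + k).choose k + (Fintype.card σ + l).choose l := by
  obtain ⟨V, W, hle, _, _, hV, hW⟩ := range_hankel_le hφ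
  have e : (MvPolynomial σ K ⧸ apolarIdeal φ) ≃ₗ[K] LinearMap.range (hankel φ) :=
    (Submodule.Quotient.restrictScalarsEquiv K (apolarIdeal φ)).symm ≪≫ₗ
      Submodule.quotEquivOfEq _ _ (ker_hankel φ).symm ≪≫ₗ (hankel φ).quotKerEquivRange
  have hfin : Module.Finite K (LinearMap.range (hankel φ)) := Submodule.finiteDimensional_of_le hle
  refine ⟨Module.Finite.equiv e.symm, ?_⟩
  rw [e.finrank_eq]
  calc _ ≤ _ := Submodule.finrank_mono hle
    _ ≤ _ := Submodule.finrank_add_le_finrank_add_finrank V W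
    _ ≤ _ := add_le_add hV hW

end Apolarity

section Coordinates

variable {s : ℕ} {n d : Fin s → ℕ}

theorem weight_varDegree_apply (m : Var n →₀ ℕ) (j : Fin s) :
    Finsupp.weight (varDegree n) m j = ∑ i, m ⟨j, i⟩ := by
  rw [Finsupp.weight_apply, Finsupp.sum_fintype _ _ (by simp), Finset.sum_apply, Fintype.sum_sigma]
  simp [varDegree, Pi.single_apply]

/-- The affine coordinates on the chart of the product of projective spaces where the variables
`x_{0,j}` have coefficient `1`; `⟨j, i⟩` corresponds to `x_{i+1,j}`. -/
abbrev AffineVar (n : Fin s → ℕ) : Type := Σ j : Fin s, Fin (n j)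

/-- The exponent obtained by dropping the variables `x_{0,j}`. -/
noncomputable def dehomogenize (m : Var n →₀ ℕ) : AffineVar n →₀ ℕ :=
  Finsupp.equivFunOnFinite.symm fun w => m ⟨w.1, w.2.succ⟩

@[simp]
theorem dehomogenize_apply (m : Var n →₀ ℕ) (w : AffineVar n) :
    dehomogenize m w = m ⟨w.1, w.2.succ⟩ := rfl

theorem apply_zero_add_sum_dehomogenize {m : Var n →₀ ℕ}
    (hm : Finsupp.weight (varDegree n) m = d) (j : Fin s) :
    m ⟨j, 0⟩ + ∑ i, dehomogenize m ⟨j, i⟩ = d j := by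
  rw [← hm, weight_varDegree_apply, Fin.sum_univ_succ]
  rfl

theorem eq_of_dehomogenize_eq {m m' : Var n →₀ ℕ} (hm : Finsupp.weight (varDegree n) m = d)
    (hm' : Finsupp.weight (varDegree n) m' = d) (h : dehomogenize m = dehomogenize m') :
    m = m' := by
  ext ⟨j, i⟩
  refine Fin.cases ?_ (fun i => ?_) i
  · have h1 := apply_zero_add_sum_dehomogenize hm j
    have h2 := apply_zero_add_sum_dehomogenize hm' j
    rw [h] at h1
    omega
  · exact DFunLike.congr_fun h ⟨j, i⟩

theorem degree_dehomogenize_le {m : Var n →₀ ℕ} (hm : Finsupp.weight (varDegree n) m = d) :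
    (dehomogenize m).degree ≤ ∑ j, d j := by
  rw [Finsupp.degree_eq_sum, Fintype.sum_sigma]
  exact Finset.sum_le_sum fun j _ => (apply_zero_add_sum_dehomogenize hm j) ▸ Nat.le_add_left _ _

theorem dehomogenize_apply_le {m : Var n →₀ ℕ} (hm : Finsupp.weight (varDegree n) m = d)
    (w : AffineVar n) : dehomogenize m w ≤ d w.1 := by
  have h := apply_zero_add_sum_dehomogenize hm w.1
  have h' := Finset.single_le_sum (f := fun i => dehomogenize m ⟨w.1, i⟩)
    (fun _ _ => Nat.zero_le _) (Finset.mem_univ w.2)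
  exact h'.trans (by omega)

theorem exists_dehomogenize_eq (μ : AffineVar n →₀ ℕ) (hμ : ∀ j, ∑ i, μ ⟨j, i⟩ ≤ d j) :
    ∃ m : Exponent n d, dehomogenize m.1 = μ := by
  let m : Var n →₀ ℕ := Finsupp.equivFunOnFinite.symm fun v =>
    Fin.cases (motive := fun _ => ℕ) (d v.1 - ∑ i, μ ⟨v.1, i⟩) (fun i => μ ⟨v.1, i⟩) v.2
  have hm : Finsupp.weight (varDegree n) m = d := by
    funext j
    rw [weight_varDegree_apply, Fin.sum_univ_succ]
    exact Nat.sub_add_cancel (hμ j)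
  exact ⟨⟨m, hm⟩, Finsupp.ext fun _ => rfl⟩

theorem prod_factorial_add_single {ι : Type*} [Fintype ι] (m : ι →₀ ℕ) (v : ι) :
    ∏ w, ((m + Finsupp.single v 1 : ι →₀ ℕ) w).factorial = (m v + 1) * ∏ w, (m w).factorial := by
  classical
  rw [← Finset.mul_prod_erase Finset.univ _ (Finset.mem_univ v),
    ← Finset.mul_prod_erase Finset.univ (fun w => (m w).factorial) (Finset.mem_univ v), ← mul_assoc]
  congr 1
  · simp [Nat.factorial_succ]
  · refine Finset.prod_congr rfl fun w hw => ?_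
    simp [Finsupp.single_eq_of_ne (Finset.ne_of_mem_erase hw)]

variable {K : Type u} [Field K]

theorem coeff_aeval_C_mul_X {σ : Type*} (b : σ → K) (m : σ →₀ ℕ) (p : MvPolynomial σ K) :
    (MvPolynomial.aeval (fun v => MvPolynomial.C (b v) * MvPolynomial.X v) p :
      MvPolynomial σ K).coeff m = p.coeff m * m.prod fun v e => b v ^ e := by
  classical
  induction p using MvPolynomial.induction_on' with
  | add p q hp hq => rw [map_add, MvPolynomial.coeff_add, MvPolynomial.coeff_add, hp, hq, add_mul]
  | monomial m' c =>
    have : (MvPolynomial.aeval (fun v => MvPolynomial.C (b v) * MvPolynomial.X v)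
        (MvPolynomial.monomial m' c) : MvPolynomial σ K) =
        MvPolynomial.C (m'.prod fun v e => b v ^ e) * MvPolynomial.monomial m' c := by
      rw [MvPolynomial.aeval_monomial, MvPolynomial.monomial_eq]
      simp only [mul_pow, Finsupp.prod_mul, MvPolynomial.algebraMap_eq]
      simp only [Finsupp.prod, map_prod, map_pow]
      ring
    rw [this, MvPolynomial.coeff_C_mul, MvPolynomial.coeff_monomial]
    split_ifs with h
    · rw [h, mul_comm]
    · simp

theorem segreVeronese_apply (a : (j : Fin s) → Fin (n j + 1) → K) (m : Exponent n d) :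
    segreVeronese n d a m =
      segreVeronese n d (fun _ _ => 1) m * ∏ v : Var n, a v.1 v.2 ^ m.1 v := by
  have h : ∏ j, linearForm n j (a j) ^ d j =
      MvPolynomial.aeval (fun v : Var n => MvPolynomial.C (a v.1 v.2) * MvPolynomial.X v)
        (∏ j, linearForm n j (fun _ => (1 : K)) ^ d j) := by
    simp [linearForm]
  rw [segreVeronese, coords, h, coeff_aeval_C_mul_X, Finsupp.prod_fintype _ _ (by simp)]
  rfl

theorem prod_factorial_mul_coeff {N : ℕ} : ∀ (d : Fin s → ℕ) (m : Var n →₀ ℕ),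
    ∑ j, d j = N → Finsupp.weight (varDegree n) m = d →
      ((∏ v, (m v).factorial : ℕ) : K) *
        (∏ j, linearForm n j (fun _ => (1 : K)) ^ d j).coeff m =
      ((∏ j, (d j).factorial : ℕ) : K) := by
  classical
  induction N with
  | zero =>
    intro d m hd hm
    have hd0 : d = 0 := by
      funext j
      simpa using (Finset.sum_eq_zero_iff.mp hd) j (Finset.mem_univ j)
    subst hd0
    have hm0 : m = 0 := by
      ext ⟨j, i⟩
      have h := weight_varDegree_apply m j
      rw [hm] at h
      exact (Finset.sum_eq_zero_iff.mp h.symm) i (Finset.mem_univ i)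
    simp [hm0]
  | succ N ih =>
    intro d m hd hm
    obtain ⟨j, hj⟩ : ∃ j, d j ≠ 0 := by
      by_contra! h
      simp [h] at hd
    let d' := d - Pi.single j 1
    have hdd : d = d' + Pi.single j 1 := by
      funext j'
      rcases eq_or_ne j' j with rfl | h
      · simp [d']; omega
      · simp [d', h]
    have hd' : ∑ j, d' j = N := by
      rw [hdd] at hd
      simpa [Finset.sum_add_distrib] using hd
    have hP : ∏ j, linearForm n j (fun _ => (1 : K)) ^ d j =
        (∏ j, linearForm n j (fun _ => (1 : K)) ^ d' j) * ∑ i, MvPolynomial.X ⟨j, i⟩ := by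
      rw [hdd]
      simp only [Pi.add_apply, pow_add, Finset.prod_mul_distrib]
      congr 1
      rw [Finset.prod_eq_single j (by intro b _ hb; simp [hb]) (by simp)]
      simp [linearForm]
    have hfac : ∏ j, (d j).factorial = d j * ∏ j, (d' j).factorial := by
      have := prod_factorial_add_single (Finsupp.equivFunOnFinite.symm d') j
      have hdj : d j = d' j + 1 := by rw [hdd]; simp
      rw [hdj]
      refine Eq.trans (Finset.prod_congr rfl fun j' _ => ?_) this
      rw [hdd]
      simp [Finsupp.single_apply, Pi.single_apply, eq_comm]
    rw [hP, Finset.mul_sum, MvPolynomial.coeff_sum, Finset.mul_sum, hfac, Nat.cast_mul,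
      ← hm, weight_varDegree_apply, Nat.cast_sum, Finset.sum_mul]
    refine Finset.sum_congr rfl fun i _ => ?_
    rw [MvPolynomial.coeff_mul_X']
    split_ifs with hi
    · have hmi : m - Finsupp.single ⟨j, i⟩ 1 + Finsupp.single ⟨j, i⟩ 1 = m :=
        tsub_add_cancel_of_le (by
          rw [Finsupp.single_le_iff]
          exact Nat.one_le_iff_ne_zero.mpr (Finsupp.mem_support_iff.mp hi))
      set m' := m - Finsupp.single (⟨j, i⟩ : Var n) 1
      have hm' : Finsupp.weight (varDegree n) m' = d' := by
        rw [← hmi, map_add, hdd] at hm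
        refine add_right_cancel (hm.trans ?_)
        simp [Finsupp.weight_single, varDegree]
      rw [← hmi, prod_factorial_add_single, Nat.cast_mul, mul_assoc, ih d' m' hd' hm']
      simp
    · rw [Finsupp.notMem_support_iff.mp hi]
      simp

theorem cast_factorial_ne_zero {k N : ℕ} (hchar : ringChar K = 0 ∨ N < ringChar K) (hk : k ≤ N) :
    (k.factorial : K) ≠ 0 := by
  rw [Ne, ringChar.spec]
  rcases hchar with h | h
  · rw [h, zero_dvd_iff]
    exact Nat.factorial_ne_zero k
  · rcases CharP.char_is_prime_or_zero K (ringChar K) with hp | h0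
    · rw [hp.dvd_factorial]
      omega
    · omega

theorem segreVeronese_one_ne_zero (hchar : ringChar K = 0 ∨ ∑ j, d j < ringChar K)
    (m : Exponent n d) : segreVeronese n d (fun _ _ => (1 : K)) m ≠ 0 := by
  refine right_ne_zero_of_mul ((prod_factorial_mul_coeff d m.1 rfl m.2).trans_ne ?_)
  rw [Nat.cast_prod, Finset.prod_ne_zero_iff]
  exact fun j _ => cast_factorial_ne_zero hchar
    (Finset.single_le_sum (fun _ _ => Nat.zero_le _) (Finset.mem_univ j))

theorem segreVeronese_one_of_dehomogenize_eq_zero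
    (hchar : ringChar K = 0 ∨ ∑ j, d j < ringChar K) (m : Exponent n d)
    (hm : dehomogenize m.1 = 0) : segreVeronese n d (fun _ _ => (1 : K)) m = 1 := by
  have h := prod_factorial_mul_coeff (K := K) d m.1 rfl m.2
  have hfac : ∏ v, (m.1 v).factorial = ∏ j, (d j).factorial := by
    rw [Fintype.prod_sigma]
    refine Finset.prod_congr rfl fun j _ => ?_
    have h0 := apply_zero_add_sum_dehomogenize m.2 j
    have h1 (i : Fin (n j)) : m.1 ⟨j, i.succ⟩ = 0 := DFunLike.congr_fun hm ⟨j, i⟩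
    rw [hm] at h0
    rw [Fin.prod_univ_succ]
    simp [h1, ← h0]
  rw [hfac] at h
  refine mul_left_cancel₀ ?_ (h.trans (mul_one _).symm)
  rw [Nat.cast_prod, Finset.prod_ne_zero_iff]
  exact fun j _ => cast_factorial_ne_zero hchar
    (Finset.single_le_sum (fun _ _ => Nat.zero_le _) (Finset.mem_univ j))

variable (K) in
/-- The Segre–Veronese map on the chart where the variables `x_{0,j}` have coefficient `1`. -/
noncomputable def affineSegreVeronese (m : Exponent n d) : MvPolynomial (AffineVar n) K :=
  MvPolynomial.monomial (dehomogenize m.1) (segreVeronese n d (fun _ _ => 1) m)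

theorem eval_affineSegreVeronese (y : AffineVar n → K) (m : Exponent n d) :
    MvPolynomial.eval y (affineSegreVeronese K m) =
      segreVeronese n d (fun j => Fin.cons 1 fun i => y ⟨j, i⟩) m := by
  rw [segreVeronese_apply, affineSegreVeronese, MvPolynomial.eval_monomial,
    Finsupp.prod_fintype _ _ (by simp), Fintype.prod_sigma, Fintype.prod_sigma]
  simp [Fin.prod_univ_succ]

theorem aeval_affineSegreVeronese_eq_zero [Infinite K] (g : MvPolynomial (Exponent n d) K)
    (hg : ∀ a ∈ segreVeroneseVariety K n d, MvPolynomial.eval a g = 0) :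
    MvPolynomial.aeval (affineSegreVeronese K) g = (0 : MvPolynomial (AffineVar n) K) := by
  refine MvPolynomial.funext fun y => ?_
  rw [map_zero, ← hg _ ⟨fun j => Fin.cons 1 fun i => y ⟨j, i⟩,
    fun j h => one_ne_zero (congrFun h 0), rfl⟩, ← MvPolynomial.coe_aeval_eq_eval,
    ← MvPolynomial.coe_aeval_eq_eval]
  simp only [RingHom.coe_coe, ← AlgHom.comp_apply, MvPolynomial.comp_aeval]
  congr 2
  funext m
  simpa using eval_affineSegreVeronese y m

/-- The functional on polynomials in the affine coordinates that is apolar to `f`: it sends the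
`m`-th coordinate of the Segre–Veronese map to the `m`-th coefficient of `f`. -/
noncomputable def apolarFunctional (d : Fin s → ℕ) (f : MvPolynomial (Var n) K) :
    MvPolynomial (AffineVar n) K →ₗ[K] K :=
  ∑ m ∈ f.support, (f.coeff m /
    (∏ j, linearForm n j (fun _ => (1 : K)) ^ d j).coeff m) •
      MvPolynomial.lcoeff K (dehomogenize m)

theorem apolarFunctional_apply (f : MvPolynomial (Var n) K) (h : MvPolynomial (AffineVar n) K) :
    apolarFunctional d f h = ∑ m ∈ f.support, f.coeff m /
      (∏ j, linearForm n j (fun _ => (1 : K)) ^ d j).coeff m * h.coeff (dehomogenize m) := by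
  simp [apolarFunctional]

variable {f : MvPolynomial (Var n) K}

theorem apolarFunctional_monomial_of_lt (hf : IsMultihomogeneous n d f) (μ : AffineVar n →₀ ℕ)
    (c : K) (hμ : ∑ j, d j < μ.degree) :
    apolarFunctional d f (MvPolynomial.monomial μ c) = 0 := by
  classical
  rw [apolarFunctional_apply]
  refine Finset.sum_eq_zero fun m hm => ?_
  have := degree_dehomogenize_le (hf (MvPolynomial.mem_support_iff.mp hm))
  rw [MvPolynomial.coeff_monomial, if_neg (by rintro rfl; omega), mul_zero]

theorem apolarFunctional_affineSegreVeronese (hf : IsMultihomogeneous n d f)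
    (hchar : ringChar K = 0 ∨ ∑ j, d j < ringChar K) (m : Exponent n d) :
    apolarFunctional d f (affineSegreVeronese K m) = coords n d f m := by
  classical
  rw [apolarFunctional_apply, Finset.sum_eq_single m.1]
  · rw [affineSegreVeronese, MvPolynomial.coeff_monomial, if_pos rfl]
    exact div_mul_cancel₀ _ (segreVeronese_one_ne_zero hchar m)
  · intro m' hm' hne
    rw [affineSegreVeronese, MvPolynomial.coeff_monomial, if_neg, mul_zero]
    exact fun h => hne (eq_of_dehomogenize_eq
      (hf (MvPolynomial.mem_support_iff.mp hm')) m.2 h.symm)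
  · intro h
    rw [MvPolynomial.notMem_support_iff.mp h, zero_div, zero_mul]

theorem X_mem_apolarIdeal (hf : IsMultihomogeneous n d f) (w : AffineVar n) (hw : d w.1 = 0) :
    MvPolynomial.X w ∈ apolarIdeal (apolarFunctional d f) := by
  classical
  intro h
  rw [apolarFunctional_apply]
  refine Finset.sum_eq_zero fun m hm => ?_
  have := dehomogenize_apply_le (hf (MvPolynomial.mem_support_iff.mp hm)) w
  rw [MvPolynomial.coeff_X_mul', if_neg (by rw [Finsupp.mem_support_iff]; omega), mul_zero]

theorem adjoin_affineSegreVeronese_eq_top (hf : IsMultihomogeneous n d f)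
    (hchar : ringChar K = 0 ∨ ∑ j, d j < ringChar K) :
    Algebra.adjoin K (Set.range fun m : Exponent n d =>
      Ideal.Quotient.mkₐ K (apolarIdeal (apolarFunctional d f)) (affineSegreVeronese K m)) = ⊤ := by
  classical
  set π := Ideal.Quotient.mkₐ K (apolarIdeal (apolarFunctional d f))
  set B := Algebra.adjoin K (Set.range fun m : Exponent n d => π (affineSegreVeronese K m))
  have hX (w : AffineVar n) : π (MvPolynomial.X w) ∈ B := by
    by_cases hw : d w.1 = 0
    · rw [show π (MvPolynomial.X w) = 0 from
        Ideal.Quotient.eq_zero_iff_mem.mpr (X_mem_apolarIdeal hf w hw)]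
      exact zero_mem B
    · obtain ⟨m, hm⟩ := exists_dehomogenize_eq (d := d) (Finsupp.single w 1) fun j => by
        obtain ⟨j', i⟩ := w
        rcases eq_or_ne j j' with rfl | hj
        · simpa [Finsupp.single_apply] using Nat.one_le_iff_ne_zero.mpr hw
        · simp [hj.symm]
      have h : MvPolynomial.X w = (segreVeronese n d (fun _ _ => (1 : K)) m)⁻¹ •
          affineSegreVeronese K m := by
        rw [affineSegreVeronese, hm, MvPolynomial.smul_monomial, smul_eq_mul,
          inv_mul_cancel₀ (segreVeronese_one_ne_zero hchar m)]
        rfl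
      rw [h, map_smul]
      exact B.smul_mem (Algebra.subset_adjoin ⟨m, rfl⟩) _
  rw [eq_top_iff]
  intro x _
  obtain ⟨p, rfl⟩ := Ideal.Quotient.mkₐ_surjective K (apolarIdeal (apolarFunctional d f)) x
  change p ∈ B.comap π
  have : Algebra.adjoin K (Set.range MvPolynomial.X) ≤ B.comap π :=
    Algebra.adjoin_le (by rintro _ ⟨w, rfl⟩; exact hX w)
  rw [MvPolynomial.adjoin_range_X] at this
  exact this Algebra.mem_top

theorem apolarFunctional_aeval_of_isHomogeneous_one (hf : IsMultihomogeneous n d f)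
    (hchar : ringChar K = 0 ∨ ∑ j, d j < ringChar K) (l : MvPolynomial (Exponent n d) K)
    (hl : l.IsHomogeneous 1) :
    apolarFunctional d f (MvPolynomial.aeval (affineSegreVeronese K) l) =
      MvPolynomial.eval (coords n d f) l := by
  have hl' : l ∈ MvPolynomial.homogeneousSubmodule (Exponent n d) K 1 := hl
  rw [MvPolynomial.homogeneousSubmodule_one_eq_span_X] at hl'
  clear hl
  induction hl' using Submodule.span_induction with
  | mem x hx =>
    obtain ⟨m, rfl⟩ := hx
    rw [MvPolynomial.aeval_X, MvPolynomial.eval_X,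
      apolarFunctional_affineSegreVeronese hf hchar m]
  | zero => simp
  | add x y _ _ hx hy => rw [map_add, map_add, map_add, hx, hy]
  | smul c x _ hx => rw [map_smul, map_smul, hx, MvPolynomial.smul_eval, smul_eq_mul]

theorem cactusRank_le [Infinite K] (hf : IsMultihomogeneous n d f)
    (hchar : ringChar K = 0 ∨ ∑ j, d j < ringChar K) {k l : ℕ} (hkl : ∑ j, d j = k + l + 1) :
    cactusRank n d f ≤
      ((((∑ j, n j) + k).choose k + ((∑ j, n j) + l).choose l : ℕ) : ℕ∞) := by
  let I := apolarIdeal (apolarFunctional d f)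
  obtain ⟨_, hrank⟩ := finite_and_finrank_quotient_apolarIdeal_le (k := k) (l := l)
    fun m c hm => apolarFunctional_monomial_of_lt hf m c (hkl ▸ hm)
  obtain ⟨v, hv⟩ := exists_dehomogenize_eq (n := n) (d := d) 0 (by simp)
  obtain ⟨Z, hlength, hZ⟩ := exists_zeroDimSubscheme (K := K) (A := MvPolynomial (AffineVar n) K ⧸ I)
    (fun m => Ideal.Quotient.mkₐ K I (affineSegreVeronese K m)) v
    (by
      rw [affineSegreVeronese, hv, segreVeronese_one_of_dehomogenize_eq_zero hchar v hv]
      exact map_one _)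
    (adjoin_affineSegreVeronese_eq_top hf hchar)
  have haeval (g : MvPolynomial (Exponent n d) K) :
      MvPolynomial.aeval (fun m => Ideal.Quotient.mkₐ K I (affineSegreVeronese K m)) g =
        Ideal.Quotient.mkₐ K I (MvPolynomial.aeval (affineSegreVeronese K) g) := by
    rw [← AlgHom.comp_apply, MvPolynomial.comp_aeval]
  have hle : cactusRank n d f ≤ (Z.length : ℕ∞) :=
    sInf_le ⟨Z, fun t g hg h => ?_, fun l hl h => ?_, rfl⟩
  · refine hle.trans ?_
    rw [hlength, Nat.cast_le]
    simpa using hrank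
  · rw [hZ, haeval, aeval_affineSegreVeronese_eq_zero g h, map_zero]
  · rw [hZ, haeval] at h
    rw [← apolarFunctional_aeval_of_isHomogeneous_one hf hchar l hl]
    simpa using Ideal.Quotient.eq_zero_iff_mem.mp h 1

end Coordinates

end CactusRank

theorem theorem1p1 {K : Type u} [Field K] [IsAlgClosed K] {s : ℕ} (n d : Fin s → ℕ)
    (hchar : ringChar K = 0 ∨ ∑ j, d j < ringChar K)
    (f : MvPolynomial (CactusRank.Var n) K) (hf : CactusRank.IsMultihomogeneous n d f)
    (hf0 : f ≠ 0) (k : ℕ) :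
    (∑ j, d j = 2 * k + 2 →
      CactusRank.cactusRank n d f ≤
        ((((∑ j, n j) + k).choose k + ((∑ j, n j) + k + 1).choose (k + 1) : ℕ) : ℕ∞)) ∧
    (∑ j, d j = 2 * k + 1 →
      CactusRank.cactusRank n d f ≤ ((2 * ((∑ j, n j) + k).choose k : ℕ) : ℕ∞)) := by
  have := IsAlgClosed.instInfinite (K := K)
  refine ⟨fun h => ?_, fun h => ?_⟩
  · exact CactusRank.cactusRank_le (k := k) (l := k + 1) hf hchar (by omega)
  · rw [two_mul]
    exact CactusRank.cactusRank_le hf hchar (by omega)
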